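/- Let $\mathbb K$ be $\mathbb R$ or $\mathbb C$. For a sequence $v=(v_j)_{j\in\mathbb Z}$ of positive weights and $1\le p<\infty$, let $\ell^p(v,\mathbb Z)$ be the Banach space of all $x=(x_j)_{j\in\mathbb Z}$ in $\mathbb K$ with $\|x\|=\big(\sum_{j\in\mathbb Z}|x_j|^p v_j\big)^{1/p}<\infty$. The upper density of $A\subset\mathbb N$ is $\limsup_{n\to\infty}\mathrm{card}(A\cap[1,n])/n$. There exists a sequence of positive weights $v$ such that, for every $1\le p<\infty$, the bilateral forward shift $T$, $(Tx)_j=x_{j-1}$ for $j\in\mathbb Z$, is a bounded linear operator on $X=\ell^p(v,\mathbb Z)$ with bounded inverse, and each $R\in\{T,T^{-1}\}$ has the following properties. 1. $R$ is completely absolutely mean irregular: for every $x\in X\setminus\{0\}$, $$\liminf_{N\to\infty}\frac1N\sum_{j=1}^N\|R^jx\|=0\quad\text{and}\quad\limsup_{N\to\infty}\frac1N\sum_{j=1}^N\|R^jx\|=\infty .$$ 2. $R$ is completely distributionally irregular: for every $x\in X\setminus\{0\}$ there are sets $A,B\subset\mathbb N$ of upper density $1$ such that $\lim_{n\to\infty,\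 n\in A}R^nx=0$ and $\lim_{n\to\infty,\ n\in B}\|R^nx\|=\infty$. 3. $R$ is hypercyclic: there is $x\in X$ such that for every nonempty open $U\subset X$ there is $n\in\mathbb N$ with $R^nx\in U$. 4. The whole space $X$ is a mean Li-Yorke set for $R$: $X$ is uncountable and, for all $x\neq y$ in $X$, $$\liminf_{N\to\infty}\frac1N\sum_{j=1}^N\|R^jx-R^jy\|=0\quad\text{and}\quad\limsup_{N\to\infty}\frac1N\sum_{j=1}^N\|R^jx-R^jy\|>0 .$$ -/

import Mathlib

open Filter Topology

/-! ### Weighted `ℓ^p` spaces over `ℤ` -/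

section WeightedSpace

/-- A weight sequence `(v_j)_{j ∈ ℤ}` of strictly positive real numbers. -/
abbrev Weight : Type := ℤ → {r : ℝ // 0 < r}

theorem weighted_term_eq {p : ℝ} (hp : 1 ≤ p) {r a : ℝ} (hr : 0 < r) (ha : 0 ≤ a) :
    (r ^ (1 / p) * a) ^ p = a ^ p * r := by
  have hp0 : p ≠ 0 := by linarith
  rw [Real.mul_rpow (Real.rpow_nonneg hr.le _) ha, ← Real.rpow_mul hr.le, one_div,
    inv_mul_cancel₀ hp0, Real.rpow_one, mul_comm]

theorem weighted_add {p : ℝ} (hp : 1 ≤ p) {𝕜 : Type*} [RCLike 𝕜] (v : Weight) {x y : ℤ → 𝕜}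
    (hx : Summable fun j => ‖x j‖ ^ p * (v j : ℝ))
    (hy : Summable fun j => ‖y j‖ ^ p * (v j : ℝ)) :
    (Summable fun j => ‖x j + y j‖ ^ p * (v j : ℝ)) ∧
      (∑' j, ‖x j + y j‖ ^ p * (v j : ℝ)) ^ (1 / p) ≤
        (∑' j, ‖x j‖ ^ p * (v j : ℝ)) ^ (1 / p) + (∑' j, ‖y j‖ ^ p * (v j : ℝ)) ^ (1 / p) := by
  have hw : ∀ j, 0 ≤ (v j : ℝ) ^ (1 / p) := fun j => Real.rpow_nonneg (v j).2.le _
  have hx' := hx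
  have hy' := hy
  simp only [← weighted_term_eq hp (v _).2 (norm_nonneg _)] at hx' hy'
  have key := Real.Lp_add_le_tsum_of_nonneg hp (fun j => mul_nonneg (hw j) (norm_nonneg (x j)))
    (fun j => mul_nonneg (hw j) (norm_nonneg (y j))) hx' hy'
  simp only [← mul_add] at key
  simp only [weighted_term_eq hp (v _).2 (norm_nonneg _),
    weighted_term_eq hp (v _).2 (add_nonneg (norm_nonneg (_ : 𝕜)) (norm_nonneg (_ : 𝕜)))] at key
  have hle : ∀ j, ‖x j + y j‖ ^ p * (v j : ℝ) ≤ (‖x j‖ + ‖y j‖) ^ p * (v j : ℝ) := fun j =>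
    mul_le_mul_of_nonneg_right
      (Real.rpow_le_rpow (norm_nonneg _) (norm_add_le _ _) (by linarith)) (v j).2.le
  have hnn : ∀ j, 0 ≤ ‖x j + y j‖ ^ p * (v j : ℝ) := fun j =>
    mul_nonneg (Real.rpow_nonneg (norm_nonneg _) _) (v j).2.le
  have hs : Summable fun j => ‖x j + y j‖ ^ p * (v j : ℝ) := Summable.of_nonneg_of_le hnn hle key.1
  refine ⟨hs, le_trans ?_ key.2⟩
  exact Real.rpow_le_rpow (tsum_nonneg hnn) (hs.tsum_le_tsum hle key.1)
    (one_div_nonneg.2 (by linarith))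

variable (𝕜 : Type*) [RCLike 𝕜] (p : ℝ) [hp : Fact (1 ≤ p)] (v : Weight)

/-- The sequences `x : ℤ → 𝕜` with `∑ |x_j|^p v_j < ∞`, as a linear subspace. -/
def weightedLpSubmodule : Submodule 𝕜 (ℤ → 𝕜) where
  carrier := {x | Summable fun j => ‖x j‖ ^ p * (v j : ℝ)}
  zero_mem' := by
    have hp0 : p ≠ 0 := by linarith [hp.out]
    simp [Real.zero_rpow hp0, summable_zero]
  add_mem' := fun hx hy => (weighted_add hp.out v hx hy).1
  smul_mem' := fun c x hx => by
    have hx' : Summable fun j => ‖x j‖ ^ p * (v j : ℝ) := hx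
    have h := hx'.mul_left (‖c‖ ^ p)
    simpa [Real.mul_rpow (norm_nonneg c), mul_assoc] using h

/-- The space `ℓ^p(v, ℤ)` of sequences `x : ℤ → 𝕜` with `∑ |x_j|^p v_j < ∞`. (A type of its own,
so that its topology is the one of the norm below, not that of pointwise convergence.) -/
def WeightedLp : Type _ := weightedLpSubmodule 𝕜 p v

namespace WeightedLp

instance : AddCommGroup (WeightedLp 𝕜 p v) :=
  inferInstanceAs (AddCommGroup (weightedLpSubmodule 𝕜 p v))

instance : Module 𝕜 (WeightedLp 𝕜 p v) :=
  inferInstanceAs (Module 𝕜 (weightedLpSubmodule 𝕜 p v))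

/-- The coordinates of an element of `ℓ^p(v, ℤ)`. -/
instance : CoeFun (WeightedLp 𝕜 p v) (fun _ => ℤ → 𝕜) := ⟨fun x => x.1⟩

/-- The norm `‖x‖ = (∑ |x_j|^p v_j)^{1/p}`. -/
noncomputable instance : Norm (WeightedLp 𝕜 p v) :=
  ⟨fun x => (∑' j, ‖x j‖ ^ p * (v j : ℝ)) ^ (1 / p)⟩

variable {𝕜 p v}

theorem summable (x : WeightedLp 𝕜 p v) : Summable fun j => ‖x j‖ ^ p * (v j : ℝ) := x.2

theorem norm_def (x : WeightedLp 𝕜 p v) :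
    ‖x‖ = (∑' j, ‖x j‖ ^ p * (v j : ℝ)) ^ (1 / p) := rfl

theorem ext {x y : WeightedLp 𝕜 p v} (h : ∀ j, x j = y j) : x = y := Subtype.ext (funext h)

@[simp] theorem add_apply (x y : WeightedLp 𝕜 p v) (j : ℤ) : (x + y) j = x j + y j := rfl

@[simp] theorem smul_apply (c : 𝕜) (x : WeightedLp 𝕜 p v) (j : ℤ) : (c • x) j = c * x j := rfl

@[simp] theorem zero_apply (j : ℤ) : (0 : WeightedLp 𝕜 p v) j = 0 := rfl

theorem term_nonneg (x : WeightedLp 𝕜 p v) (j : ℤ) : 0 ≤ ‖x j‖ ^ p * (v j : ℝ) :=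
  mul_nonneg (Real.rpow_nonneg (norm_nonneg _) _) (v j).2.le

theorem core : NormedSpace.Core 𝕜 (WeightedLp 𝕜 p v) where
  norm_nonneg x := Real.rpow_nonneg (tsum_nonneg (term_nonneg x)) _
  norm_smul c x := by
    have hp0 : p ≠ 0 := by linarith [hp.out]
    simp only [norm_def, smul_apply, norm_mul, Real.mul_rpow (norm_nonneg c) (norm_nonneg _),
      mul_assoc, tsum_mul_left]
    rw [Real.mul_rpow (Real.rpow_nonneg (norm_nonneg _) _) (tsum_nonneg (term_nonneg x)),
      ← Real.rpow_mul (norm_nonneg _), mul_one_div_cancel hp0, Real.rpow_one]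
  norm_triangle x y := (weighted_add hp.out v x.2 y.2).2
  norm_eq_zero_iff x := by
    have hp0 : p ≠ 0 := by linarith [hp.out]
    constructor
    · intro h
      rw [norm_def, Real.rpow_eq_zero (tsum_nonneg (term_nonneg x)) (one_div_ne_zero hp0)] at h
      refine ext fun j => ?_
      have hj : ‖x j‖ ^ p * (v j : ℝ) = 0 :=
        le_antisymm (((summable x).le_tsum j fun i _ => term_nonneg x i).trans h.le)
          (term_nonneg x j)
      have h2 := (mul_eq_zero.1 hj).resolve_right (v j).2.ne'
      simpa using (Real.rpow_eq_zero (norm_nonneg _) hp0).1 h2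
    · rintro rfl
      simp [norm_def, Real.zero_rpow hp0, Real.zero_rpow (inv_ne_zero hp0)]

noncomputable instance : NormedAddCommGroup (WeightedLp 𝕜 p v) :=
  NormedAddCommGroup.ofCore (core (𝕜 := 𝕜))

noncomputable instance : NormedSpace 𝕜 (WeightedLp 𝕜 p v) :=
  NormedSpace.ofCore core

/-- `ℓ^p(v, ℤ)` is a Banach space: `x ↦ (v_j^{1/p} x_j)_j` is an isometry onto `ℓ^p(ℤ)`. -/
instance : CompleteSpace (WeightedLp 𝕜 p v) := by
  have h1 : 1 ≤ p := hp.out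
  have hp0 : 0 < p := by linarith
  have : Fact ((1 : ENNReal) ≤ ENNReal.ofReal p) := ⟨ENNReal.one_le_ofReal.2 h1⟩
  have hpr : (ENNReal.ofReal p).toReal = p := ENNReal.toReal_ofReal hp0.le
  have hpos : 0 < (ENNReal.ofReal p).toReal := by rw [hpr]; exact hp0
  have hw : ∀ j, 0 < (v j : ℝ) ^ (1 / p) := fun j => Real.rpow_pos_of_pos (v j).2 _
  have hterm : ∀ (j : ℤ) (a : 𝕜),
      ‖(((v j : ℝ) ^ (1 / p) : ℝ) : 𝕜) * a‖ ^ p = ‖a‖ ^ p * (v j : ℝ) := fun j a => by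
    rw [norm_mul, RCLike.norm_ofReal, abs_of_pos (hw j),
      weighted_term_eq h1 (v j).2 (norm_nonneg a)]
  let f : WeightedLp 𝕜 p v → lp (fun _ : ℤ => 𝕜) (ENNReal.ofReal p) := fun x =>
    ⟨fun j => (((v j : ℝ) ^ (1 / p) : ℝ) : 𝕜) * x j, by
      refine (memℓp_gen_iff hpos).2 ?_
      simp only [hpr, hterm]
      exact x.2⟩
  have hiso : Isometry f := by
    refine Isometry.of_dist_eq fun x y => ?_
    have hsub : f x - f y = f (x - y) := by
      ext j
      exact (mul_sub _ _ _).symm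
    rw [dist_eq_norm, dist_eq_norm, hsub, lp.norm_eq_tsum_rpow hpos, norm_def]
    simp only [hpr]
    simp only [f, hterm]
  have hsurj : Function.Surjective f := fun y => by
    have hy := (memℓp_gen_iff hpos).1 y.2
    have hmul : ∀ j, (((v j : ℝ) ^ (1 / p) : ℝ) : 𝕜) *
        ((((v j : ℝ) ^ (1 / p) : ℝ) : 𝕜)⁻¹ * y j) = y j := fun j =>
      mul_inv_cancel_left₀ (RCLike.ofReal_ne_zero.2 (hw j).ne') _
    refine ⟨⟨fun j => (((v j : ℝ) ^ (1 / p) : ℝ) : 𝕜)⁻¹ * y j, ?_⟩, ?_⟩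
    · change Summable _
      simp only [← hterm, hmul]
      simpa only [hpr] using hy
    · ext j
      exact hmul j
  exact (IsometryEquiv.mk (Equiv.ofBijective f ⟨hiso.injective, hsurj⟩)
    hiso).completeSpace

end WeightedLp

end WeightedSpace

/-! ### Dynamics of operators -/

section Dynamics

/-- The mean `(1/N) ∑_{j=1}^N a_j`, as an extended real. -/
noncomputable def cesaroMean (a : ℕ → ℝ) (N : ℕ) : EReal :=
  (((1 / (N : ℝ)) * ∑ j ∈ Finset.Icc 1 N, a j : ℝ) : EReal)

/-- The upper density `limsup_n card (A ∩ [1,n]) / n` of a set of natural numbers. -/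
noncomputable def upperDensity (A : Set ℕ) : EReal :=
  limsup (fun n : ℕ => (((A ∩ Set.Icc 1 n).ncard / (n : ℝ) : ℝ) : EReal)) atTop

variable {𝕜 : Type*} [RCLike 𝕜] {X : Type*} [NormedAddCommGroup X] [NormedSpace 𝕜 X]

def IsAbsolutelyMeanIrregular (T : X →L[𝕜] X) (x : X) : Prop :=
  liminf (cesaroMean fun j => ‖(T ^ j) x‖) atTop = 0 ∧
    limsup (cesaroMean fun j => ‖(T ^ j) x‖) atTop = ⊤

def CompletelyAbsolutelyMeanIrregular (T : X →L[𝕜] X) : Prop :=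
  ∀ x : X, x ≠ 0 → IsAbsolutelyMeanIrregular T x

/-- The orbit of `x` is distributionally near to `0` and distributionally unbounded. -/
def IsDistributionallyIrregular (T : X →L[𝕜] X) (x : X) : Prop :=
  (∃ A : Set ℕ, upperDensity A = 1 ∧
    Tendsto (fun n : ℕ => (T ^ n) x) (atTop ⊓ 𝓟 A) (𝓝 0)) ∧
  (∃ B : Set ℕ, upperDensity B = 1 ∧
    Tendsto (fun n : ℕ => ‖(T ^ n) x‖) (atTop ⊓ 𝓟 B) atTop)

def CompletelyDistributionallyIrregular (T : X →L[𝕜] X) : Prop :=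
  ∀ x : X, x ≠ 0 → IsDistributionallyIrregular T x

def IsHypercyclic (T : X →L[𝕜] X) : Prop :=
  ∃ x : X, ∀ U : Set X, IsOpen U → U.Nonempty → {n : ℕ | (T ^ n) x ∈ U}.Nonempty

def IsMeanLiYorkePair (T : X →L[𝕜] X) (x y : X) : Prop :=
  liminf (cesaroMean fun j => ‖(T ^ j) x - (T ^ j) y‖) atTop = 0 ∧
    0 < limsup (cesaroMean fun j => ‖(T ^ j) x - (T ^ j) y‖) atTop

def IsMeanLiYorkeSet (T : X →L[𝕜] X) (S : Set X) : Prop :=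
  ¬ S.Countable ∧ ∀ x ∈ S, ∀ y ∈ S, x ≠ y → IsMeanLiYorkePair T x y

end Dynamics

/-- `T` is the bilateral forward shift on `ℓ^p(v, ℤ)`: `(T x)_j = x_{j-1}`, so that it maps the
unit vector `e_j` to `e_{j+1}`. -/
def IsForwardShift {𝕜 : Type*} [RCLike 𝕜] {p : ℝ} [Fact (1 ≤ p)] {v : Weight}
    (T : WeightedLp 𝕜 p v → WeightedLp 𝕜 p v) : Prop :=
  ∀ (x : WeightedLp 𝕜 p v) (j : ℤ), (T x) j = x (j - 1)

/-!
The weight is `v_j = w |j|` with `w n = exp (½ r sin r)`, `r = √(1 + log (n + 1))`. It has two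
features. It oscillates between `0` and `∞`, and it does so slowly: as a function of `n + 1` it
changes by a factor of at most `√K` when `n + 1` changes by a factor of `K` (`SlowlyVarying`). Being
even, it treats the forward and the backward shift alike, so let `R` be the shift by `σ = ±1`; then
`‖R^n x‖ ^ p = ∑_j |x_j| ^ p v_{j + σ n}`.

*Small orbits.* Let `N` be a record minimum of `w`, that is `w N ≤ w i` for all `i ≤ N`. Because
`n ↦ n ^ (-1/2)` has averages over `[1, N]` comparable to `N ^ (-1/2)`, slow variation bounds the
averages of `v` over windows of length `N` near the origin by a multiple of `w N`, which is at most
a multiple of `v_j`; far from the origin `v` is almost constant on such a window. Hence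
`(1/N) ∑_{n ≤ N} v_{j + σ n} ≤ 64 v_j` for every `j` (`SlowlyVarying.sum_le`), while for fixed `j`
the average is at most `32 w N`, which tends to `0` along record minima. Dominated convergence gives
that the means of `‖R^n x‖ ^ p`, and by Jensen's inequality those of `‖R^n x‖`, tend to `0` along
the record minima, for *every* `x` (`IsShiftBy.tendsto_mean`).

*Large orbits.* If `w N` is large, then `w n` is large for all `n` between `δ N` and `N`. So a
nonzero coordinate of `x` forces `‖R^n x‖` to be large for a proportion of `n ≤ N` as close to `1`
as desired (`IsShiftBy.largeCounts`).

Markov's inequality and a diagonal choice of sets (`exists_upperDensity_one_of_antitone`) turn these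
two facts into the sets of upper density `1`. Since the means of `‖R^n x‖ + ‖R^{-n} y‖` are small
along the same sequence, some `n` has both `R^n x` and `R^{-n} y` small, so that `x + R^{-n} y` is
near `x` and its image under `R^n` near `y`: `R` is topologically transitive, and Baire's theorem
gives a dense orbit. The mean Li-Yorke property of a pair `x, y` is absolute mean irregularity of
`x - y`.
-/

/-! ### A slowly oscillating weight -/

/-- `w` varies at most as fast as the square root: if `m + 1` and `n + 1` are within a factor `K`
of each other, then `w m` and `w n` are within a factor `√K`. An exponent below `1` is what makes
the averages of `w` over `[0, N]` comparable to `w N`. -/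
def SlowlyVarying (w : ℕ → ℝ) : Prop :=
  ∀ (m n : ℕ) (K : ℝ), (m : ℝ) + 1 ≤ K * (n + 1) → (n : ℝ) + 1 ≤ K * (m + 1) → w m ≤ √K * w n

/-- The logarithm of the weight as a function of `s = log (n + 1)`: with `r = √(1 + s)` it is
`½ r sin r`, which is `½`-Lipschitz on `s ≥ 0` and unbounded in both directions. -/
noncomputable def oscPhase (s : ℝ) : ℝ := √(1 + s) * Real.sin √(1 + s) / 2

theorem oscPhase_lipschitz {s t : ℝ} (hs : 0 ≤ s) (ht : 0 ≤ t) :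
    oscPhase s - oscPhase t ≤ |s - t| / 2 := by
  set a := √(1 + s) with ha
  set b := √(1 + t) with hb
  have ha1 : 1 ≤ a := Real.one_le_sqrt.2 (by linarith)
  have hb1 : 1 ≤ b := Real.one_le_sqrt.2 (by linarith)
  have hst : s - t = (a - b) * (a + b) := by
    have h1 : a ^ 2 = 1 + s := Real.sq_sqrt (by linarith)
    have h2 : b ^ 2 = 1 + t := Real.sq_sqrt (by linarith)
    linear_combination h2 - h1
  have h1 : (a - b) * Real.sin a ≤ |a - b| := by
    refine (le_abs_self _).trans ?_
    rw [abs_mul]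
    exact mul_le_of_le_one_right (abs_nonneg _) (Real.abs_sin_le_one a)
  have h2 : b * (Real.sin a - Real.sin b) ≤ b * |a - b| :=
    mul_le_mul_of_nonneg_left ((le_abs_self _).trans (Real.abs_sin_sub_sin_le a b)) (by linarith)
  have h3 : |s - t| = |a - b| * (a + b) := by
    rw [hst, abs_mul, abs_of_pos (by linarith : 0 < a + b)]
  -- Here `1 ≤ a` turns the factor `1 + b` into the `a + b` of `s - t = (a - b) (a + b)`.
  have h4 : |a - b| * (1 + b) ≤ |a - b| * (a + b) :=
    mul_le_mul_of_nonneg_left (by linarith) (abs_nonneg _)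
  have h5 : oscPhase s - oscPhase t
      = ((a - b) * Real.sin a + b * (Real.sin a - Real.sin b)) / 2 := by
    simp only [oscPhase, ← ha, ← hb]; ring
  rw [h5, h3]
  linarith

/-- The slowly varying weight on `ℕ`, with `oscPhase` at `log (n + 1)` as its logarithm. -/
noncomputable def oscWeight (n : ℕ) : ℝ := Real.exp (oscPhase (Real.log (n + 1)))

theorem oscWeight_pos (n : ℕ) : 0 < oscWeight n := Real.exp_pos _

theorem log_succ_nonneg (n : ℕ) : 0 ≤ Real.log ((n : ℝ) + 1) :=
  Real.log_nonneg (by linarith [(Nat.cast_nonneg n : (0 : ℝ) ≤ n)])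

theorem oscWeight_slowlyVarying : SlowlyVarying oscWeight := by
  intro m n K h1 h2
  have hm : (0 : ℝ) < m + 1 := by positivity
  have hn : (0 : ℝ) < n + 1 := by positivity
  have hK : 0 < K := pos_of_mul_pos_left (hm.trans_le h1) hn.le
  have e1 := Real.log_le_log hm h1
  have e2 := Real.log_le_log hn h2
  rw [Real.log_mul hK.ne' hn.ne'] at e1
  rw [Real.log_mul hK.ne' hm.ne'] at e2
  have h3 : |Real.log ((m : ℝ) + 1) - Real.log (n + 1)| ≤ Real.log K :=
    abs_le.2 ⟨by linarith, by linarith⟩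
  have h4 := oscPhase_lipschitz (log_succ_nonneg m) (log_succ_nonneg n)
  have h5 : √K = Real.exp (Real.log K / 2) := by
    rw [Real.exp_half, Real.exp_log hK]
  rw [h5, oscWeight, oscWeight, ← Real.exp_add]
  exact Real.exp_le_exp.2 (by linarith)

/-- Every value `½ r sin r` is attained up to an error of `1` at some `log (n + 1)`, where `n`
is large if `r` is; this allows `r` to be chosen where `sin r = ±1`. -/
theorem exists_oscPhase_log_near {r : ℝ} (hr : 1 ≤ r) :
    ∃ n : ℕ, r ≤ n + 1 ∧ |oscPhase (Real.log (n + 1)) - r * Real.sin r / 2| ≤ 1 := by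
  have hr2 : 0 ≤ r ^ 2 - 1 := by nlinarith
  -- `s = r ^ 2 - 1` solves `√(1 + s) = r`.
  refine ⟨⌊Real.exp (r ^ 2 - 1)⌋₊, ?_, ?_⟩
  · have := Nat.lt_floor_add_one (Real.exp (r ^ 2 - 1))
    have := Real.add_one_le_exp (r ^ 2 - 1)
    nlinarith
  · set n := ⌊Real.exp (r ^ 2 - 1)⌋₊
    have h1 : Real.exp (r ^ 2 - 1) < (n : ℝ) + 1 := Nat.lt_floor_add_one _
    have h2 : (n : ℝ) ≤ Real.exp (r ^ 2 - 1) := Nat.floor_le (Real.exp_pos _).le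
    have h3 : 1 ≤ Real.exp (r ^ 2 - 1) := Real.one_le_exp hr2
    have hn : (0 : ℝ) < n + 1 := by positivity
    have h4 : r ^ 2 - 1 ≤ Real.log (n + 1) := (Real.le_log_iff_exp_le hn).2 h1.le
    have h5 : Real.log ((n : ℝ) + 1) ≤ r ^ 2 - 1 + 1 := by
      rw [Real.log_le_iff_le_exp hn, Real.exp_add]
      nlinarith [Real.exp_one_gt_d9]
    have hphase : oscPhase (r ^ 2 - 1) = r * Real.sin r / 2 := by
      rw [oscPhase, show 1 + (r ^ 2 - 1) = r ^ 2 by ring, Real.sqrt_sq (by linarith)]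
    have habs : |Real.log ((n : ℝ) + 1) - (r ^ 2 - 1)| ≤ 1 :=
      abs_le.2 ⟨by linarith, by linarith⟩
    have h6 := oscPhase_lipschitz (log_succ_nonneg n) hr2
    have h7 := oscPhase_lipschitz hr2 (log_succ_nonneg n)
    rw [abs_sub_comm] at h7
    rw [← hphase]
    exact abs_le.2 ⟨by linarith, by linarith⟩

theorem frequently_le_oscWeight (L : ℝ) : ∃ᶠ n in atTop, L ≤ oscWeight n := by
  refine frequently_atTop.2 fun n₀ => ?_
  obtain ⟨k, hk⟩ := exists_nat_ge (2 * (|L| + 1) + n₀ + 1)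
  have hk0 : (0 : ℝ) ≤ k := k.cast_nonneg
  have hπ := Real.pi_gt_three
  set r : ℝ := Real.pi / 2 + k * (2 * Real.pi) with hr
  have hrk : (k : ℝ) + 1 ≤ r := by rw [hr]; nlinarith
  have hsin : Real.sin r = 1 := by rw [hr, Real.sin_add_nat_mul_two_pi, Real.sin_pi_div_two]
  obtain ⟨n, hn, hosc⟩ := exists_oscPhase_log_near (r := r) (by linarith)
  rw [hsin] at hosc
  refine ⟨n, ?_, ?_⟩
  · have : (n₀ : ℝ) ≤ n := by linarith [abs_nonneg L]
    exact_mod_cast this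
  · have h1 := (abs_le.1 hosc).1
    have h2 := Real.add_one_le_exp (oscPhase (Real.log ((n : ℝ) + 1)))
    have := le_abs_self L
    have : (0 : ℝ) ≤ n₀ := n₀.cast_nonneg
    rw [oscWeight]
    linarith

theorem frequently_oscWeight_le {ε : ℝ} (hε : 0 < ε) : ∃ᶠ n in atTop, oscWeight n ≤ ε := by
  refine frequently_atTop.2 fun n₀ => ?_
  obtain ⟨k, hk⟩ := exists_nat_ge (2 * (|Real.log ε| + 1) + n₀ + 1)
  have hk0 : (0 : ℝ) ≤ k := k.cast_nonneg
  have hπ := Real.pi_gt_three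
  set r : ℝ := (Real.pi / 2 + Real.pi) + k * (2 * Real.pi) with hr
  have hrk : (k : ℝ) + 1 ≤ r := by rw [hr]; nlinarith
  have hsin : Real.sin r = -1 := by
    rw [hr, Real.sin_add_nat_mul_two_pi, Real.sin_add_pi, Real.sin_pi_div_two]
  obtain ⟨n, hn, hosc⟩ := exists_oscPhase_log_near (r := r) (by linarith)
  rw [hsin] at hosc
  refine ⟨n, ?_, ?_⟩
  · have : (n₀ : ℝ) ≤ n := by linarith [abs_nonneg (Real.log ε)]
    exact_mod_cast this
  · have h1 := (abs_le.1 hosc).2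
    have := neg_abs_le (Real.log ε)
    have : (0 : ℝ) ≤ n₀ := n₀.cast_nonneg
    rw [oscWeight, ← Real.le_log_iff_exp_le hε]
    linarith

/-- Arbitrarily late record minima with arbitrarily small values: the first index at which `w` drops
to a threshold below all the earlier values. -/
theorem exists_record_min {w : ℕ → ℝ} (hpos : ∀ n, 0 < w n)
    (hinf : ∀ ε > 0, ∃ᶠ n in atTop, w n ≤ ε) {ε : ℝ} (hε : 0 < ε) (n₀ : ℕ) :
    ∃ N, n₀ ≤ N ∧ w N ≤ ε ∧ ∀ i ≤ N, w N ≤ w i := by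
  classical
  obtain ⟨δ, hδ, hδε, hδw⟩ : ∃ δ > 0, δ ≤ ε ∧ ∀ i < n₀, δ < w i := by
    induction n₀ with
    | zero => exact ⟨ε, hε, le_rfl, by simp⟩
    | succ n ih =>
      obtain ⟨δ, h0, h1, h2⟩ := ih
      refine ⟨min δ (w n / 2), lt_min h0 (half_pos (hpos n)), (min_le_left _ _).trans h1, ?_⟩
      intro i hi
      rcases Nat.lt_succ_iff_lt_or_eq.1 hi with hi | rfl
      · exact (min_le_left _ _).trans_lt (h2 i hi)
      · exact (min_le_right _ _).trans_lt (half_lt_self (hpos i))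
  have hex : ∃ n, w n ≤ δ := (hinf δ hδ).exists
  refine ⟨Nat.find hex, ?_, (Nat.find_spec hex).trans hδε, fun i hi => ?_⟩
  · by_contra! hlt
    exact absurd (Nat.find_spec hex) (not_le.2 (hδw _ hlt))
  · rcases hi.lt_or_eq with hi | rfl
    · exact (Nat.find_spec hex).trans (not_le.1 (Nat.find_min hex hi)).le
    · exact le_rfl

/-- Record minima of `oscWeight` tending to infinity, along which the weight tends to `0`. -/
theorem exists_record_min_seq : ∃ N : ℕ → ℕ, Tendsto N atTop atTop ∧
    (∀ k, ∀ i ≤ N k, oscWeight (N k) ≤ oscWeight i) ∧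
    Tendsto (fun k => oscWeight (N k)) atTop (𝓝 0) := by
  choose N h1 h2 h3 using fun k : ℕ => exists_record_min oscWeight_pos
    (fun ε hε => frequently_oscWeight_le hε) (ε := 1 / ((k : ℝ) + 1)) (by positivity) k
  exact ⟨N, tendsto_atTop_mono h1 tendsto_id, h3,
    squeeze_zero (fun k => (oscWeight_pos _).le) h2 tendsto_one_div_add_atTop_nhds_zero_nat⟩

/-! ### Averages of a slowly varying weight over windows -/

/-- Comparison of `∑ (m + 1) ^ (-1/2)` with the integral of `t ^ (-1/2)`. -/
theorem sum_inv_sqrt_le (M : ℕ) :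
    ∑ m ∈ Finset.range M, 1 / √((m : ℝ) + 1) ≤ 2 * √M := by
  induction M with
  | zero => simp
  | succ M ih =>
    rw [Finset.sum_range_succ]
    have hb : 0 < √((M : ℝ) + 1) := Real.sqrt_pos.2 (by positivity)
    have ha : 0 ≤ √(M : ℝ) := Real.sqrt_nonneg _
    have ha2 : √(M : ℝ) ^ 2 = M := Real.sq_sqrt (by positivity)
    have hb2 : √((M : ℝ) + 1) ^ 2 = M + 1 := Real.sq_sqrt (by positivity)
    have : 1 / √((M : ℝ) + 1) ≤ 2 * (√((M : ℝ) + 1) - √M) := by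
      rw [div_le_iff₀ hb]
      nlinarith [sq_nonneg (√((M : ℝ) + 1) - √M)]
    push_cast
    linarith

theorem SlowlyVarying.le_two_mul {w : ℕ → ℝ} (hw : SlowlyVarying w) (hpos : ∀ n, 0 < w n)
    {m n : ℕ} (h1 : m + 1 ≤ 3 * (n + 1)) (h2 : n + 1 ≤ 3 * (m + 1)) : w m ≤ 2 * w n := by
  refine (hw m n 3 (by exact_mod_cast h1) (by exact_mod_cast h2)).trans ?_
  refine mul_le_mul_of_nonneg_right ?_ (hpos n).le
  exact Real.sqrt_le_iff.2 ⟨by norm_num, by norm_num⟩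

/-- The average of `w` over `[0, 3N]` is at most a constant times `w N`. -/
theorem SlowlyVarying.sum_range_le {w : ℕ → ℝ} (hw : SlowlyVarying w) (hpos : ∀ n, 0 < w n)
    {N : ℕ} (hN : 1 ≤ N) : ∑ m ∈ Finset.range (3 * N + 1), w m ≤ 16 * N * w N := by
  -- The first summand bounds `w m / w N` for `m ≤ N`, the second one for `N ≤ m ≤ 3N`.
  have hterm : ∀ m ∈ Finset.range (3 * N + 1),
      w m ≤ w N * (√((N : ℝ) + 1) * (1 / √((m : ℝ) + 1)) + 2) := by
    intro m hm
    have hm' : m ≤ 3 * N := by simpa [Nat.lt_succ_iff] using hm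
    have hN0 := hpos N
    have hm0 : (0 : ℝ) < m + 1 := by positivity
    rcases le_total m N with h | h
    · have hmN : (m : ℝ) ≤ N := by exact_mod_cast h
      have h1 := hw m N (((N : ℝ) + 1) / (m + 1)) ?_ ?_
      · rw [Real.sqrt_div (by positivity)] at h1
        refine h1.trans ?_
        rw [mul_comm, mul_one_div]
        gcongr
        linarith
      · rw [div_mul_eq_mul_div, le_div_iff₀ hm0]
        nlinarith
      · rw [div_mul_cancel₀ _ hm0.ne']
    · have h1 : w m ≤ 2 * w N := hw.le_two_mul hpos (by omega) (by omega)
      have h2 : 0 ≤ w N * (√((N : ℝ) + 1) * (1 / √((m : ℝ) + 1))) := by positivity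
      linarith
  refine (Finset.sum_le_sum hterm).trans ?_
  rw [← Finset.mul_sum, Finset.sum_add_distrib, ← Finset.mul_sum]
  have h1 := sum_inv_sqrt_le (3 * N + 1)
  have h2 : √((N : ℝ) + 1) ≤ √((3 * N + 1 : ℕ) : ℝ) := by
    apply Real.sqrt_le_sqrt; push_cast; linarith [(N.cast_nonneg : (0 : ℝ) ≤ N)]
  have h3 : √((3 * N + 1 : ℕ) : ℝ) * √((3 * N + 1 : ℕ) : ℝ) = 3 * N + 1 := by
    rw [Real.mul_self_sqrt (by positivity)]; push_cast; ring
  have h4 : √((N : ℝ) + 1) * ∑ m ∈ Finset.range (3 * N + 1), 1 / √((m : ℝ) + 1)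
      ≤ 2 * (3 * N + 1) := by
    calc _ ≤ √((3 * N + 1 : ℕ) : ℝ) * (2 * √((3 * N + 1 : ℕ) : ℝ)) :=
          mul_le_mul h2 h1 (Finset.sum_nonneg fun _ _ => by positivity) (Real.sqrt_nonneg _)
      _ = 2 * (3 * N + 1) := by rw [← h3]; ring
  have hN1 : (1 : ℝ) ≤ N := by exact_mod_cast hN
  simp only [Finset.sum_const, Finset.card_range, nsmul_eq_mul]
  push_cast
  have := hpos N
  nlinarith

/-- A window of the even extension of `w` that lies in `[-M, M]` has at most two indices of each
absolute value. -/
theorem sum_natAbs_window_le {w : ℕ → ℝ} (hpos : ∀ n, 0 < w n) {σ : ℤ} (hσ : σ.natAbs = 1)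
    {j : ℤ} {N M : ℕ} (hM : j.natAbs + N ≤ M) :
    ∑ n ∈ Finset.Icc 1 N, w (j + σ * n).natAbs ≤ 2 * ∑ m ∈ Finset.range (M + 1), w m := by
  classical
  have hinj : Set.InjOn (fun n : ℕ => j + σ * n) (Finset.Icc 1 N : Finset ℕ) := by
    intro a _ b _ h
    have h0 : σ ≠ 0 := by rintro rfl; simp at hσ
    have : σ * (a : ℤ) = σ * b := by simpa using h
    exact_mod_cast mul_left_cancel₀ h0 this
  rw [← Finset.sum_image (f := fun i : ℤ => w i.natAbs) hinj]
  set P := (Finset.range (M + 1)).image (fun m : ℕ => (m : ℤ))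
  set Q := (Finset.range (M + 1)).image (fun m : ℕ => -(m : ℤ))
  have hP : ∑ i ∈ P, w i.natAbs = ∑ m ∈ Finset.range (M + 1), w m := by
    rw [Finset.sum_image (by intro a _ b _ h; simpa using h)]
    simp
  have hQ : ∑ i ∈ Q, w i.natAbs = ∑ m ∈ Finset.range (M + 1), w m := by
    rw [Finset.sum_image (by intro a _ b _ h; simpa using h)]
    simp
  have hsub : (Finset.Icc 1 N).image (fun n : ℕ => j + σ * n) ⊆ P ∪ Q := by
    intro i hi
    obtain ⟨n, hn, rfl⟩ := Finset.mem_image.1 hi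
    have hn2 := (Finset.mem_Icc.1 hn).2
    have h1 : (j + σ * n).natAbs ≤ M := by
      have := Int.natAbs_add_le j (σ * n)
      rw [Int.natAbs_mul, hσ, Int.natAbs_natCast] at this
      omega
    rcases Int.natAbs_eq (j + σ * n) with h | h
    · exact Finset.mem_union_left _ (Finset.mem_image.2 ⟨_, Finset.mem_range.2 (by omega), h.symm⟩)
    · exact Finset.mem_union_right _
        (Finset.mem_image.2 ⟨_, Finset.mem_range.2 (by omega), h.symm⟩)
  have hle : ∑ i ∈ P ∪ Q, w i.natAbs ≤ ∑ i ∈ P, w i.natAbs + ∑ i ∈ Q, w i.natAbs := by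
    rw [← Finset.sum_union_inter]
    exact le_add_of_nonneg_right (Finset.sum_nonneg fun _ _ => (hpos _).le)
  calc _ ≤ ∑ i ∈ P ∪ Q, w i.natAbs :=
        Finset.sum_le_sum_of_subset_of_nonneg hsub fun _ _ _ => (hpos _).le
    _ ≤ _ := by rw [hP, hQ] at hle; linarith

theorem SlowlyVarying.sum_near_le {w : ℕ → ℝ} (hw : SlowlyVarying w) (hpos : ∀ n, 0 < w n)
    {σ : ℤ} (hσ : σ.natAbs = 1) {N : ℕ} (hN : 1 ≤ N) {j : ℤ} (hj : j.natAbs ≤ 2 * N) :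
    ∑ n ∈ Finset.Icc 1 N, w (j + σ * n).natAbs ≤ 32 * N * w N := by
  have h1 := sum_natAbs_window_le hpos hσ (j := j) (N := N) (M := 3 * N) (by omega)
  have h2 := hw.sum_range_le hpos hN
  linarith

/-- At a record minimum `N`, the averages of the even extension of `w` over windows of length `N`
next to `j` are at most a constant times its value at `j`, uniformly in `j`. -/
theorem SlowlyVarying.sum_le {w : ℕ → ℝ} (hw : SlowlyVarying w) (hpos : ∀ n, 0 < w n)
    {σ : ℤ} (hσ : σ.natAbs = 1) {N : ℕ} (hN : 1 ≤ N) (hmin : ∀ i ≤ N, w N ≤ w i) (j : ℤ) :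
    ∑ n ∈ Finset.Icc 1 N, w (j + σ * n).natAbs ≤ 64 * N * w j.natAbs := by
  have hj0 := hpos j.natAbs
  have hN0 : (0 : ℝ) ≤ N := N.cast_nonneg
  rcases le_total j.natAbs (2 * N) with hj | hj
  · have h1 := hw.sum_near_le hpos hσ hN hj
    have h2 : w N ≤ 2 * w j.natAbs := by
      rcases le_total j.natAbs N with h | h
      · linarith [hmin _ h]
      · exact hw.le_two_mul hpos (by omega) (by omega)
    nlinarith
  · have hterm : ∀ n ∈ Finset.Icc 1 N, w (j + σ * n).natAbs ≤ 2 * w j.natAbs := by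
      intro n hn
      have hn2 := (Finset.mem_Icc.1 hn).2
      have h3 : (σ * n).natAbs = n := by rw [Int.natAbs_mul, hσ, Int.natAbs_natCast, one_mul]
      apply hw.le_two_mul hpos <;> omega
    refine (Finset.sum_le_sum hterm).trans ?_
    simp only [Finset.sum_const, Nat.card_Icc, nsmul_eq_mul, Nat.add_sub_cancel]
    nlinarith [mul_nonneg hN0 hj0.le]

theorem SlowlyVarying.le_natAbs_add {w : ℕ → ℝ} (hw : SlowlyVarying w) {σ : ℤ}
    (hσ : σ.natAbs = 1) (j : ℤ) (n : ℕ) :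
    w n ≤ √((j.natAbs : ℝ) + 1) * w (j + σ * n).natAbs := by
  have h3 : (σ * n).natAbs = n := by rw [Int.natAbs_mul, hσ, Int.natAbs_natCast, one_mul]
  have h1 : (n + 1) ≤ (j.natAbs + 1) * ((j + σ * n).natAbs + 1) := by
    have : n ≤ j.natAbs + (j + σ * n).natAbs := by omega
    nlinarith [Nat.zero_le (j.natAbs * (j + σ * n).natAbs)]
  have h2 : ((j + σ * n).natAbs + 1) ≤ (j.natAbs + 1) * (n + 1) := by
    have : (j + σ * n).natAbs ≤ j.natAbs + n := by omega
    nlinarith [Nat.zero_le (j.natAbs * n)]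
  exact hw _ _ _ (by exact_mod_cast h1) (by exact_mod_cast h2)

/-! ### Upper density and Cesàro means -/

/-- For every `ε > 0`, the set `A` contains at least `(1 - ε) N` of the integers in `[1, N]` for
arbitrarily large `N`. This is upper density at least `1`, in terms of real numbers. -/
def LargeCounts (A : Set ℕ) : Prop :=
  ∀ ε > (0 : ℝ), ∃ᶠ N : ℕ in atTop, (1 - ε) * N ≤ (A ∩ Set.Icc 1 N).ncard

theorem ncard_Icc_one (N : ℕ) : (Set.Icc 1 N).ncard = N := by
  rw [← Finset.coe_Icc, Set.ncard_coe_finset, Nat.card_Icc, Nat.add_sub_cancel]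

theorem ncard_inter_Icc_le (A : Set ℕ) (N : ℕ) : (A ∩ Set.Icc 1 N).ncard ≤ N := by
  have := Set.ncard_le_ncard (Set.inter_subset_right : A ∩ Set.Icc 1 N ⊆ _) (Set.finite_Icc 1 N)
  rwa [ncard_Icc_one] at this

theorem LargeCounts.upperDensity_eq_one {A : Set ℕ} (hA : LargeCounts A) :
    upperDensity A = 1 := by
  refine le_antisymm ?_ ?_
  · refine limsup_le_of_le (h := Eventually.of_forall fun n => ?_)
    have h : ((A ∩ Set.Icc 1 n).ncard : ℝ) / n ≤ 1 :=
      div_le_one_of_le₀ (by exact_mod_cast ncard_inter_Icc_le A n) n.cast_nonneg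
    exact_mod_cast h
  · refine EReal.ge_of_forall_gt_iff_ge.1 fun c hc => ?_
    have hc' : c < 1 := by exact_mod_cast hc
    refine le_limsup_of_frequently_le ?_
    refine ((hA (1 - c) (by linarith)).and_eventually (eventually_gt_atTop 0)).mono ?_
    rintro N ⟨hN, hN0⟩
    have hN0' : (0 : ℝ) < N := by exact_mod_cast hN0
    have : c ≤ ((A ∩ Set.Icc 1 N).ncard : ℝ) / N := by
      rw [le_div_iff₀ hN0']; linarith
    exact_mod_cast this

/-- Diagonal choice: for a decreasing sequence of sets with large counts there is one set of upper
density `1` that is eventually contained in each of them. -/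
theorem exists_upperDensity_one_of_antitone {P : ℕ → Set ℕ} (hP : Antitone P)
    (hcount : ∀ k, LargeCounts (P k)) :
    ∃ A : Set ℕ, upperDensity A = 1 ∧ ∀ k, ∀ᶠ n in atTop ⊓ 𝓟 A, n ∈ P k := by
  obtain ⟨N, hNmono, hN⟩ := extraction_forall_of_frequently
    fun k : ℕ => hcount k (1 / ((k : ℝ) + 1)) (by positivity)
  refine ⟨{n | ∀ k, N k < n → n ∈ P k}, ?_, fun k => ?_⟩
  · refine LargeCounts.upperDensity_eq_one fun ε hε => ?_
    have hev : ∀ᶠ k : ℕ in atTop, 1 / ((k : ℝ) + 1) < ε :=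
      tendsto_one_div_add_atTop_nhds_zero_nat.eventually_lt_const hε
    refine hNmono.tendsto_atTop.frequently (hev.mono fun k hk => ?_).frequently
    -- For `n ≤ N k` only the conditions with index below `k` are in force, and they follow from
    -- that of index `k`.
    have hsub : P k ∩ Set.Icc 1 (N k) ⊆ {n | ∀ k, N k < n → n ∈ P k} ∩ Set.Icc 1 (N k) := by
      rintro n ⟨h1, h2⟩
      refine ⟨fun i hi => hP ?_ h1, h2⟩
      exact (hNmono.lt_iff_lt.1 (hi.trans_le h2.2)).le
    have hcard : ((P k ∩ Set.Icc 1 (N k)).ncard : ℝ) ≤ _ := Nat.cast_le.2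
      (Set.ncard_le_ncard hsub ((Set.finite_Icc 1 (N k)).subset Set.inter_subset_right))
    refine le_trans ?_ ((hN k).trans hcard)
    gcongr
  · rw [eventually_inf_principal]
    filter_upwards [eventually_gt_atTop (N k)] with n hn hA using hA k hn

/-- Markov's inequality for counts in `[1, N]`. -/
theorem ncard_mul_le_sum {a : ℕ → ℝ} (ha : ∀ n, 0 ≤ a n) {c : ℝ} {S : Set ℕ}
    (hS : ∀ n ∈ S, c ≤ a n) (N : ℕ) :
    ((S ∩ Set.Icc 1 N).ncard : ℝ) * c ≤ ∑ n ∈ Finset.Icc 1 N, a n := by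
  classical
  have h1 : (S ∩ Set.Icc 1 N) = (((Finset.Icc 1 N).filter (· ∈ S) : Finset ℕ) : Set ℕ) := by
    ext n; simp only [Set.mem_inter_iff, Set.mem_Icc, Finset.coe_filter, Finset.mem_Icc,
      Set.mem_ofPred_eq, and_comm]
  rw [h1, Set.ncard_coe_finset, ← nsmul_eq_mul]
  calc _ ≤ ∑ n ∈ (Finset.Icc 1 N).filter (· ∈ S), a n :=
        Finset.card_nsmul_le_sum _ _ _ fun n hn => hS n (Finset.mem_filter.1 hn).2
    _ ≤ _ := Finset.sum_le_sum_of_subset_of_nonneg (Finset.filter_subset _ _) fun _ _ _ => ha _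

theorem ncard_add_ncard_compl (S : Set ℕ) (N : ℕ) :
    (S ∩ Set.Icc 1 N).ncard + (Sᶜ ∩ Set.Icc 1 N).ncard = N := by
  have h := Set.ncard_inter_add_ncard_sdiff_eq_ncard (Set.Icc 1 N) S (Set.finite_Icc 1 N)
  rwa [Set.inter_comm, Set.sdiff_eq_compl_inter, ncard_Icc_one] at h

/-- The means of `a` over `[1, N]` are arbitrarily small for arbitrarily large `N`. The division
by `N` is avoided by writing it on the other side. -/
def HasSmallMeans (a : ℕ → ℝ) : Prop :=
  ∀ ε > (0 : ℝ), ∃ᶠ N : ℕ in atTop, ∑ n ∈ Finset.Icc 1 N, a n ≤ ε * N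

theorem HasSmallMeans.largeCounts {a : ℕ → ℝ} (ha : ∀ n, 0 ≤ a n) (h : HasSmallMeans a)
    {δ : ℝ} (hδ : 0 < δ) : LargeCounts {n | a n < δ} := by
  intro ε hε
  refine (h (ε * δ) (by positivity)).mono fun N hN => ?_
  have h1 := ncard_mul_le_sum ha (c := δ) (S := {n | a n < δ}ᶜ) (fun n hn => not_lt.1 hn) N
  have h2 : (({n | a n < δ} ∩ Set.Icc 1 N).ncard : ℝ) + ({n | a n < δ}ᶜ ∩ Set.Icc 1 N).ncard = N :=
    by exact_mod_cast ncard_add_ncard_compl _ N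
  have h3 : (({n | a n < δ}ᶜ ∩ Set.Icc 1 N).ncard : ℝ) ≤ ε * N := by
    refine le_of_mul_le_mul_right ?_ hδ
    linarith
  linarith

theorem HasSmallMeans.exists_tendsto_zero {a : ℕ → ℝ} (ha : ∀ n, 0 ≤ a n)
    (h : HasSmallMeans a) :
    ∃ A : Set ℕ, upperDensity A = 1 ∧ Tendsto a (atTop ⊓ 𝓟 A) (𝓝 0) := by
  obtain ⟨A, hA, hev⟩ := exists_upperDensity_one_of_antitone
    (P := fun k : ℕ => {n | a n < 1 / ((k : ℝ) + 1)})
    (fun i j hij n (hn : a n < _) => hn.trans_le (Nat.one_div_le_one_div hij))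
    (fun k => h.largeCounts ha (by positivity))
  refine ⟨A, hA, tendsto_order.2 ⟨fun c hc => Eventually.of_forall fun n => hc.trans_le (ha n),
    fun c hc => ?_⟩⟩
  obtain ⟨k, hk⟩ := exists_nat_one_div_lt hc
  exact (hev k).mono fun n hn => lt_trans hn hk

theorem HasSmallMeans.liminf_cesaroMean {a : ℕ → ℝ} (ha : ∀ n, 0 ≤ a n)
    (h : HasSmallMeans a) : liminf (cesaroMean a) atTop = 0 := by
  refine le_antisymm ?_ ?_
  · refine EReal.le_of_forall_lt_iff_le.1 fun c hc => ?_
    have hc' : 0 < c := by exact_mod_cast hc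
    refine liminf_le_of_frequently_le ?_
    refine ((h c hc').and_eventually (eventually_gt_atTop 0)).mono ?_
    rintro N ⟨hN, hN0⟩
    have hN0' : (0 : ℝ) < N := by exact_mod_cast hN0
    refine EReal.coe_le_coe_iff.2 ?_
    rw [one_div_mul_eq_div, div_le_iff₀ hN0']
    exact hN
  · refine le_liminf_of_le (h := Eventually.of_forall fun N => ?_)
    refine EReal.coe_nonneg.2 ?_
    have := Finset.sum_nonneg (s := Finset.Icc 1 N) fun n _ => ha n
    positivity

theorem exists_tendsto_atTop_of_largeCounts {a : ℕ → ℝ}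
    (h : ∀ K : ℝ, LargeCounts {n | K ≤ a n}) :
    ∃ B : Set ℕ, upperDensity B = 1 ∧ Tendsto a (atTop ⊓ 𝓟 B) atTop := by
  obtain ⟨B, hB, hev⟩ := exists_upperDensity_one_of_antitone
    (P := fun k : ℕ => {n | (k : ℝ) ≤ a n})
    (fun i j hij n (hn : (j : ℝ) ≤ a n) => le_trans (Nat.cast_le.2 hij) hn) (fun k => h k)
  refine ⟨B, hB, tendsto_atTop.2 fun c => ?_⟩
  obtain ⟨k, hk⟩ := exists_nat_ge c
  exact (hev k).mono fun n hn => hk.trans hn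

theorem limsup_cesaroMean_of_largeCounts {a : ℕ → ℝ} (ha : ∀ n, 0 ≤ a n)
    (h : ∀ K : ℝ, LargeCounts {n | K ≤ a n}) : limsup (cesaroMean a) atTop = ⊤ := by
  refine EReal.eq_top_iff_forall_lt _ |>.2 fun c => ?_
  refine lt_of_lt_of_le (b := ((|c| + 1 : ℝ) : EReal)) ?_ ?_
  · exact EReal.coe_lt_coe_iff.2 (by linarith [le_abs_self c])
  refine le_limsup_of_frequently_le ?_
  refine ((h (2 * (|c| + 1)) (1 / 2) (by norm_num)).and_eventually (eventually_gt_atTop 0)).mono ?_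
  rintro N ⟨hN, hN0⟩
  have hN0' : (0 : ℝ) < N := by exact_mod_cast hN0
  have h1 := ncard_mul_le_sum ha (fun n (hn : n ∈ {n | 2 * (|c| + 1) ≤ a n}) => hn) N
  refine EReal.coe_le_coe_iff.2 ?_
  rw [one_div_mul_eq_div, le_div_iff₀ hN0']
  nlinarith [abs_nonneg c]

theorem HasSmallMeans.of_tendsto {a : ℕ → ℝ} {N : ℕ → ℕ} (hN : Tendsto N atTop atTop)
    (h : Tendsto (fun k => ∑ n ∈ Finset.Icc 1 (N k), 1 / (N k : ℝ) * a n) atTop (𝓝 0)) :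
    HasSmallMeans a := by
  intro ε hε
  refine hN.frequently (Eventually.frequently ?_)
  filter_upwards [h.eventually_lt_const hε, hN.eventually_gt_atTop 0] with k hk hk0
  have hk' : (0 : ℝ) < N k := by exact_mod_cast hk0
  rw [← Finset.mul_sum, one_div_mul_eq_div, div_lt_iff₀ hk'] at hk
  exact hk.le

theorem HasSmallMeans.exists_lt {a : ℕ → ℝ} (h : HasSmallMeans a) {ε : ℝ} (hε : 0 < ε) :
    ∃ n, a n < ε := by
  by_contra! hle
  obtain ⟨N, hN, hN0⟩ := ((h (ε / 2) (half_pos hε)).and_eventually (eventually_gt_atTop 0)).exists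
  have hN0' : (0 : ℝ) < N := by exact_mod_cast hN0
  have h1 := Finset.card_nsmul_le_sum (Finset.Icc 1 N) a ε fun n _ => hle n
  rw [Nat.card_Icc, Nat.add_sub_cancel, nsmul_eq_mul] at h1
  nlinarith

/-- If `w N` is large, then so is `w n` for all `n` in `(ε N, N]`. -/
theorem SlowlyVarying.largeCounts {w : ℕ → ℝ} (hw : SlowlyVarying w)
    (hsup : ∀ L : ℝ, ∃ᶠ n in atTop, L ≤ w n) (K : ℝ) : LargeCounts {n | K ≤ w n} := by
  intro ε hε
  have hsq : 0 < √(1 / ε) := Real.sqrt_pos.2 (by positivity)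
  refine (hsup (√(1 / ε) * K)).mono fun N hN => ?_
  have hN0 : (0 : ℝ) ≤ N := N.cast_nonneg
  have hsub : ((Finset.Ioc (⌊ε * N⌋₊) N : Finset ℕ) : Set ℕ) ⊆ {n | K ≤ w n} ∩ Set.Icc 1 N := by
    intro n hn
    obtain ⟨h1, h2⟩ := Finset.mem_Ioc.1 (Finset.mem_coe.1 hn)
    refine ⟨?_, by omega, h2⟩
    have h3 : ε * N < n := (Nat.floor_lt (by positivity)).1 h1
    have h2' : (n : ℝ) ≤ N := by exact_mod_cast h2
    -- If `1 ≤ ε` there is no such `n`.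
    have hε1 : ε < 1 := by
      by_contra! h
      nlinarith
    have h4 : w N ≤ √(1 / ε) * w n := by
      refine hw N n (1 / ε) ?_ ?_ <;> rw [one_div_mul_eq_div, le_div_iff₀ hε] <;> nlinarith
    exact le_of_mul_le_mul_left (hN.trans h4) hsq
  have h1 := Set.ncard_le_ncard hsub ((Set.finite_Icc 1 N).subset Set.inter_subset_right)
  rw [Set.ncard_coe_finset, Nat.card_Ioc] at h1
  have h2 : (N : ℝ) ≤ ⌊ε * N⌋₊ + ({n | K ≤ w n} ∩ Set.Icc 1 N).ncard := by
    exact_mod_cast Nat.sub_le_iff_le_add'.1 h1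
  have := Nat.floor_le (show 0 ≤ ε * N by positivity)
  linarith

/-! ### Transitivity and mean Li-Yorke sets -/

/-- Birkhoff's transitivity theorem: on a separable Banach space, a topologically transitive operator
has a dense orbit. -/
theorem isHypercyclic_of_transitive {𝕜 X : Type*} [RCLike 𝕜] [NormedAddCommGroup X]
    [NormedSpace 𝕜 X] [CompleteSpace X] [TopologicalSpace.SeparableSpace X] (R : X →L[𝕜] X)
    (h : ∀ U V : Set X, IsOpen U → U.Nonempty → IsOpen V → V.Nonempty →
      ∃ n : ℕ, ∃ x ∈ U, (R ^ n) x ∈ V) : IsHypercyclic R := by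
  have : SecondCountableTopology X := UniformSpace.secondCountable_of_separable X
  let B := TopologicalSpace.countableBasis X
  have hBc : Countable B := (TopologicalSpace.countable_countableBasis X).to_subtype
  have hd : Dense (⋂ V : B, ⋃ n : ℕ, (R ^ n) ⁻¹' (V : Set X)) := by
    refine dense_iInter_of_isOpen (fun V => isOpen_iUnion fun n =>
      (TopologicalSpace.isOpen_of_mem_countableBasis V.2).preimage (R ^ n).continuous) fun V => ?_
    rw [dense_iff_inter_open]
    intro U hU hUne
    obtain ⟨n, x, hxU, hxV⟩ := h U V hU hUne (TopologicalSpace.isOpen_of_mem_countableBasis V.2)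
      (TopologicalSpace.nonempty_of_mem_countableBasis V.2)
    exact ⟨x, hxU, Set.mem_iUnion.2 ⟨n, hxV⟩⟩
  obtain ⟨x, hx⟩ := hd.nonempty
  refine ⟨x, fun U hU ⟨u, hu⟩ => ?_⟩
  obtain ⟨V, hVB, -, hVU⟩ :=
    (TopologicalSpace.isBasis_countableBasis X).exists_subset_of_mem_open hu hU
  obtain ⟨n, hn⟩ := Set.mem_iUnion.1 (Set.mem_iInter.1 hx ⟨V, hVB⟩)
  exact ⟨n, hVU hn⟩

theorem isMeanLiYorkeSet_univ {𝕜 X : Type*} [RCLike 𝕜] [NormedAddCommGroup X]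
    [NormedSpace 𝕜 X] {R : X →L[𝕜] X} (h : CompletelyAbsolutelyMeanIrregular R)
    (hX : ¬ (Set.univ : Set X).Countable) : IsMeanLiYorkeSet R Set.univ := by
  refine ⟨hX, fun x _ y _ hxy => ?_⟩
  have h1 := h (x - y) (sub_ne_zero.2 hxy)
  simp only [IsAbsolutelyMeanIrregular, map_sub] at h1
  exact ⟨h1.1, by rw [h1.2]; exact EReal.coe_lt_top 0⟩

/-! ### Shifts and unit vectors in weighted spaces -/

section Operator

variable {𝕜 : Type*} [RCLike 𝕜] {p : ℝ} [hp : Fact (1 ≤ p)] {v : Weight} {w : ℕ → ℝ}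

namespace WeightedLp

theorem exponent_pos (p : ℝ) [hp : Fact (1 ≤ p)] : 0 < p := zero_lt_one.trans_le hp.out

theorem norm_rpow (x : WeightedLp 𝕜 p v) : ‖x‖ ^ p = ∑' j, ‖x j‖ ^ p * (v j : ℝ) := by
  rw [norm_def, ← Real.rpow_mul (tsum_nonneg (term_nonneg x)),
    one_div_mul_cancel (exponent_pos p).ne', Real.rpow_one]

theorem summable_shift {m : ℤ} {K : ℝ} (hK : ∀ j, (v (j + m) : ℝ) ≤ K * v j)
    (x : WeightedLp 𝕜 p v) : Summable fun j => ‖x j‖ ^ p * (v (j + m) : ℝ) := by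
  refine Summable.of_nonneg_of_le
    (fun j => mul_nonneg (Real.rpow_nonneg (norm_nonneg _) _) (v _).2.le) (fun j => ?_)
    ((summable x).mul_left K)
  have := Real.rpow_nonneg (norm_nonneg (x j)) p
  nlinarith [hK j]

theorem norm_le_of_shift {m : ℤ} {K : ℝ} (hK : ∀ j, (v (j + m) : ℝ) ≤ K * v j)
    {x y : WeightedLp 𝕜 p v} (hxy : ∀ j, y j = x (j - m)) : ‖y‖ ≤ K ^ (1 / p) * ‖x‖ := by
  have hp0 := exponent_pos p
  have hK0 : 0 ≤ K := le_of_mul_le_mul_right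
    (by rw [zero_mul]; exact (v (0 + m)).2.le.trans (hK 0)) (v 0).2
  refine (Real.rpow_le_rpow_iff (norm_nonneg _) (by positivity) hp0).1 ?_
  rw [Real.mul_rpow (by positivity) (norm_nonneg _), ← Real.rpow_mul hK0,
    one_div_mul_cancel hp0.ne', Real.rpow_one, norm_rpow, norm_rpow, ← tsum_mul_left,
    ← (Equiv.addRight m).tsum_eq]
  simp only [Equiv.coe_addRight, hxy, add_sub_cancel_right]
  refine (summable_shift hK x).tsum_le_tsum (fun j => ?_) ((summable x).mul_left K)
  have := Real.rpow_nonneg (norm_nonneg (x j)) p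
  nlinarith [hK j]

/-- The shift `(x_j) ↦ (x_{j - m})` as a bounded operator; the constant `K` bounds the ratios
`v_{j + m} / v_j`. -/
noncomputable def shift (m : ℤ) (K : ℝ) (hK : ∀ j, (v (j + m) : ℝ) ≤ K * v j) :
    WeightedLp 𝕜 p v →L[𝕜] WeightedLp 𝕜 p v :=
  LinearMap.mkContinuous
    { toFun := fun x => ⟨fun j => x (j - m), by
        refine ((Equiv.addRight m).summable_iff (f := fun j => ‖x (j - m)‖ ^ p * (v j : ℝ))).1 ?_
        simpa [Function.comp_def] using summable_shift hK x⟩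
      map_add' := fun x y => rfl
      map_smul' := fun c x => rfl }
    (K ^ (1 / p)) fun _ => norm_le_of_shift hK fun _ => rfl

theorem norm_coord_le (x : WeightedLp 𝕜 p v) (j : ℤ) : ‖x j‖ ^ p * (v j : ℝ) ≤ ‖x‖ ^ p := by
  rw [norm_rpow]
  exact (summable x).le_tsum j fun i _ => term_nonneg x i

/-- The unit vector `e_j`. -/
noncomputable def single (j : ℤ) : WeightedLp 𝕜 p v :=
  ⟨Pi.single j 1, summable_of_ne_finset_zero (s := {j}) fun i hi => by
    have : i ≠ j := by simpa using hi
    simp [Pi.single_eq_of_ne this, Real.zero_rpow (exponent_pos p).ne']⟩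

theorem single_apply (j i : ℤ) :
    (single j : WeightedLp 𝕜 p v) i = if i = j then 1 else 0 := Pi.single_apply j 1 i

theorem single_ne_zero (j : ℤ) : (single j : WeightedLp 𝕜 p v) ≠ 0 := by
  intro h
  have h1 := single_apply (𝕜 := 𝕜) (p := p) (v := v) j j
  rw [h] at h1
  simp at h1

/-- The `j`-th coordinate as a linear functional. -/
def coordLinear (j : ℤ) : WeightedLp 𝕜 p v →ₗ[𝕜] 𝕜 where
  toFun x := x j
  map_add' _ _ := rfl
  map_smul' _ _ := rfl

theorem sum_single_apply (x : WeightedLp 𝕜 p v) (F : Finset ℤ) (i : ℤ) :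
    (∑ j ∈ F, x j • (single j : WeightedLp 𝕜 p v)) i = if i ∈ F then x i else 0 := by
  change coordLinear i _ = _
  rw [map_sum]
  simp only [map_smul]
  change ∑ j ∈ F, x j • (single j : WeightedLp 𝕜 p v) i = _
  simp [single_apply]

/-- The unit vectors span a dense subspace: `x = ∑ x_j e_j` in norm. -/
theorem hasSum_single (x : WeightedLp 𝕜 p v) :
    HasSum (fun j => x j • (single j : WeightedLp 𝕜 p v)) x := by
  have hp0 := exponent_pos p
  rw [HasSum, SummationFilter.unconditional_filter, tendsto_iff_norm_sub_tendsto_zero]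
  have h1 : ∀ F : Finset ℤ, ‖∑ j ∈ F, x j • (single j : WeightedLp 𝕜 p v) - x‖
      = (∑' j : {j // j ∉ F}, ‖x j‖ ^ p * (v j : ℝ)) ^ (1 / p) := by
    intro F
    rw [norm_sub_rev, norm_def]
    congr 1
    rw [show (∑' j : {j // j ∉ F}, ‖x j‖ ^ p * (v j : ℝ)) = _ from
      tsum_subtype {j | j ∉ F} fun j => ‖x j‖ ^ p * (v j : ℝ)]
    refine tsum_congr fun j => ?_
    have h2 : (x - ∑ j ∈ F, x j • (single j : WeightedLp 𝕜 p v)) j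
        = x j - (∑ j ∈ F, x j • (single j : WeightedLp 𝕜 p v)) j := rfl
    rw [h2, sum_single_apply]
    by_cases hj : j ∈ F <;> simp [hj, Real.zero_rpow hp0.ne']
  simp only [h1]
  have h2 := (tendsto_tsum_compl_atTop_zero fun j => ‖x j‖ ^ p * (v j : ℝ)).rpow_const
    (p := 1 / p) (Or.inr (by positivity))
  rwa [Real.zero_rpow (one_div_ne_zero hp0.ne')] at h2

instance : TopologicalSpace.SeparableSpace (WeightedLp 𝕜 p v) := by
  have h1 : TopologicalSpace.IsSeparable
      (Set.range (single : ℤ → WeightedLp 𝕜 p v)) := (Set.countable_range _).isSeparable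
  have h2 := (h1.span (R := 𝕜)).closure
  refine TopologicalSpace.isSeparable_univ_iff.1 (h2.mono fun x _ => ?_)
  refine mem_closure_of_tendsto (hasSum_single x) (Eventually.of_forall fun F => ?_)
  exact Submodule.sum_mem _ fun j _ =>
    Submodule.smul_mem _ _ (Submodule.subset_span ⟨j, rfl⟩)

theorem not_countable_univ : ¬ (Set.univ : Set (WeightedLp 𝕜 p v)).Countable := by
  intro h
  have hc := Set.countable_univ_iff.1 h
  -- The line through a nonzero vector is uncountable.
  have hinj : Function.Injective
      fun t : ℝ => ((t : 𝕜) • (single 0 : WeightedLp 𝕜 p v)) := fun a b hab =>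
    RCLike.ofReal_injective (smul_left_injective 𝕜 (single_ne_zero 0) hab)
  exact not_countable (α := ℝ) hinj.countable

end WeightedLp

/-! ### Orbits of the shifts for a slowly varying weight -/

/-- `R` is the shift by `σ`, `(R x)_j = x_{j - σ}`: the forward shift for `σ = 1`, its inverse for
`σ = -1`. -/
def IsShiftBy (σ : ℤ) (R : WeightedLp 𝕜 p v →L[𝕜] WeightedLp 𝕜 p v) : Prop :=
  ∀ x j, (R x) j = x (j - σ)

theorem IsShiftBy.pow_apply {σ : ℤ} {R : WeightedLp 𝕜 p v →L[𝕜] WeightedLp 𝕜 p v}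
    (hR : IsShiftBy σ R) (n : ℕ) (x : WeightedLp 𝕜 p v) (j : ℤ) :
    ((R ^ n) x) j = x (j - σ * n) := by
  induction n generalizing x with
  | zero => simp
  | succ n ih =>
    rw [pow_succ, mul_apply_eq_comp, ih, hR]
    exact congrArg x.1 (by push_cast; ring)

theorem IsShiftBy.hasSum_norm_rpow {σ : ℤ} {R : WeightedLp 𝕜 p v →L[𝕜] WeightedLp 𝕜 p v}
    (hR : IsShiftBy σ R) (n : ℕ) (x : WeightedLp 𝕜 p v) :
    HasSum (fun j => ‖x j‖ ^ p * (v (j + σ * n) : ℝ)) (‖(R ^ n) x‖ ^ p) := by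
  rw [WeightedLp.norm_rpow]
  have h := (Equiv.addRight (σ * (n : ℤ))).hasSum_iff.2 ((R ^ n) x).summable.hasSum
  simpa only [Function.comp_def, Equiv.coe_addRight, hR.pow_apply, add_sub_cancel_right] using h

/-- Dominated convergence for the means `∑_j |x_j| ^ p (1/N) ∑_{n ≤ N} v_{j + σ n}` of
`‖R^n x‖ ^ p` along record minima `N` of the weight. -/
theorem IsShiftBy.tendsto_mean_rpow {σ : ℤ} {R : WeightedLp 𝕜 p v →L[𝕜] WeightedLp 𝕜 p v}
    (hR : IsShiftBy σ R) (hσ : σ.natAbs = 1) (hv : ∀ j, (v j : ℝ) = w j.natAbs)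
    (hw : SlowlyVarying w) (hpos : ∀ n, 0 < w n) {N : ℕ → ℕ} (hN : Tendsto N atTop atTop)
    (hmin : ∀ k, ∀ i ≤ N k, w (N k) ≤ w i) (hlim : Tendsto (fun k => w (N k)) atTop (𝓝 0))
    (x : WeightedLp 𝕜 p v) :
    Tendsto (fun k => ∑ n ∈ Finset.Icc 1 (N k), 1 / (N k : ℝ) * ‖(R ^ n) x‖ ^ p)
      atTop (𝓝 0) := by
  have hsum : ∀ k, ∑ n ∈ Finset.Icc 1 (N k), 1 / (N k : ℝ) * ‖(R ^ n) x‖ ^ p = ∑' j,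
      ‖x j‖ ^ p * (1 / (N k : ℝ) * ∑ n ∈ Finset.Icc 1 (N k), w (j + σ * n).natAbs) := by
    intro k
    have h := (hasSum_sum (s := Finset.Icc 1 (N k)) fun n _ =>
      (hR.hasSum_norm_rpow n x).mul_left (1 / (N k : ℝ))).tsum_eq
    rw [← h]
    refine tsum_congr fun j => ?_
    rw [Finset.mul_sum, Finset.mul_sum]
    refine Finset.sum_congr rfl fun n _ => ?_
    rw [hv]; ring
  simp only [hsum]
  have h1 : ∀ᶠ k in atTop, 1 ≤ N k := hN.eventually_ge_atTop 1
  have hnn : ∀ j, 0 ≤ ‖x j‖ ^ p := fun j => Real.rpow_nonneg (norm_nonneg _) _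
  have hmean : ∀ k j,
      0 ≤ 1 / (N k : ℝ) * ∑ n ∈ Finset.Icc 1 (N k), w (j + σ * n).natAbs := fun k j =>
    mul_nonneg (by positivity) (Finset.sum_nonneg fun _ _ => (hpos _).le)
  have key := tendsto_tsum_of_dominated_convergence (𝓕 := atTop)
    (f := fun k j =>
      ‖x j‖ ^ p * (1 / (N k : ℝ) * ∑ n ∈ Finset.Icc 1 (N k), w (j + σ * n).natAbs))
    (g := fun _ => (0 : ℝ)) (bound := fun j => 64 * (‖x j‖ ^ p * (v j : ℝ)))
    (x.summable.mul_left 64) ?_ ?_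
  · simpa using key
  · intro j
    have hz : Tendsto (fun k => ‖x j‖ ^ p * (32 * w (N k))) atTop (𝓝 0) := by
      simpa using (hlim.const_mul 32).const_mul (‖x j‖ ^ p)
    refine squeeze_zero' (Eventually.of_forall fun k => mul_nonneg (hnn j) (hmean k j)) ?_ hz
    filter_upwards [h1, hN.eventually_ge_atTop j.natAbs] with k hk hj
    have hk' : (0 : ℝ) < N k := by exact_mod_cast hk
    refine mul_le_mul_of_nonneg_left ?_ (hnn j)
    rw [one_div_mul_eq_div, div_le_iff₀ hk']
    linarith [hw.sum_near_le hpos hσ hk (j := j) (by omega)]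
  · filter_upwards [h1] with k hk j
    have hk' : (0 : ℝ) < N k := by exact_mod_cast hk
    rw [Real.norm_of_nonneg (mul_nonneg (hnn j) (hmean k j)), mul_left_comm 64]
    refine mul_le_mul_of_nonneg_left ?_ (hnn j)
    rw [one_div_mul_eq_div, div_le_iff₀ hk', hv]
    linarith [hw.sum_le hpos hσ hk (hmin k) j]

theorem IsShiftBy.tendsto_mean {σ : ℤ} {R : WeightedLp 𝕜 p v →L[𝕜] WeightedLp 𝕜 p v}
    (hR : IsShiftBy σ R) (hσ : σ.natAbs = 1) (hv : ∀ j, (v j : ℝ) = w j.natAbs)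
    (hw : SlowlyVarying w) (hpos : ∀ n, 0 < w n) {N : ℕ → ℕ} (hN : Tendsto N atTop atTop)
    (hmin : ∀ k, ∀ i ≤ N k, w (N k) ≤ w i) (hlim : Tendsto (fun k => w (N k)) atTop (𝓝 0))
    (x : WeightedLp 𝕜 p v) :
    Tendsto (fun k => ∑ n ∈ Finset.Icc 1 (N k), 1 / (N k : ℝ) * ‖(R ^ n) x‖)
      atTop (𝓝 0) := by
  have hp0 := WeightedLp.exponent_pos p
  have h := (hR.tendsto_mean_rpow hσ hv hw hpos hN hmin hlim x).rpow_const (p := 1 / p)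
    (Or.inr (by positivity))
  rw [Real.zero_rpow (one_div_ne_zero hp0.ne')] at h
  have hnn : ∀ k, 0 ≤ ∑ n ∈ Finset.Icc 1 (N k), 1 / (N k : ℝ) * ‖(R ^ n) x‖ := fun k =>
    Finset.sum_nonneg fun _ _ => by positivity
  refine squeeze_zero' (Eventually.of_forall hnn) ?_ h
  filter_upwards [hN.eventually_ge_atTop 1] with k hk
  have hk' : (N k : ℝ) ≠ 0 := by positivity
  have hJ := Real.rpow_arith_mean_le_arith_mean_rpow (Finset.Icc 1 (N k))
    (fun _ => 1 / (N k : ℝ)) (fun n => ‖(R ^ n) x‖) (fun _ _ => by positivity)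
    (by simp [hk']) (fun _ _ => norm_nonneg _) hp.out
  rw [one_div p]
  exact (Real.le_rpow_inv_iff_of_pos (hnn k)
    (Finset.sum_nonneg fun _ _ => by positivity) hp0).2 hJ

/-- A single nonzero coordinate makes the orbit large whenever the weight is. -/
theorem IsShiftBy.largeCounts {σ : ℤ} {R : WeightedLp 𝕜 p v →L[𝕜] WeightedLp 𝕜 p v}
    (hR : IsShiftBy σ R) (hσ : σ.natAbs = 1) (hv : ∀ j, (v j : ℝ) = w j.natAbs)
    (hw : SlowlyVarying w) (hsup : ∀ L : ℝ, ∃ᶠ n in atTop, L ≤ w n)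
    {x : WeightedLp 𝕜 p v} (hx : x ≠ 0) (K : ℝ) : LargeCounts {n | K ≤ ‖(R ^ n) x‖} := by
  obtain ⟨j, hj⟩ : ∃ j, x j ≠ 0 := by
    by_contra! h
    exact hx (WeightedLp.ext h)
  have hp0 := WeightedLp.exponent_pos p
  set C : ℝ := √((j.natAbs : ℝ) + 1)
  have hC : 0 < C := Real.sqrt_pos.2 (by positivity)
  have hxj : 0 < ‖x j‖ ^ p := Real.rpow_pos_of_pos (norm_pos_iff.2 hj) p
  have hsub : {n | C * (|K| ^ p / ‖x j‖ ^ p) ≤ w n} ⊆ {n | K ≤ ‖(R ^ n) x‖} := by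
    intro n hn
    have h1 := le_of_mul_le_mul_left
      (le_trans (show C * _ ≤ w n from hn) (hw.le_natAbs_add hσ j n)) hC
    rw [div_le_iff₀ hxj] at h1
    have h2 := WeightedLp.norm_coord_le ((R ^ n) x) (j + σ * n)
    rw [hR.pow_apply, add_sub_cancel_right, hv, mul_comm] at h2
    exact (le_abs_self K).trans
      ((Real.rpow_le_rpow_iff (abs_nonneg K) (norm_nonneg _) hp0).1 (h1.trans h2))
  intro ε hε
  refine (hw.largeCounts hsup (C * (|K| ^ p / ‖x j‖ ^ p)) ε hε).mono fun N hN =>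
    hN.trans (Nat.cast_le.2 ?_)
  exact Set.ncard_le_ncard (Set.inter_subset_inter_left _ hsub)
    ((Set.finite_Icc 1 N).subset Set.inter_subset_right)

end Operator

/-! ### The shift for the oscillating weight -/

/-- If `R` and its inverse `S` have small orbits at common times, then `x + S^n y` is close to `x`
and is mapped close to `y` by `R^n`. -/
theorem IsShiftBy.isHypercyclic {𝕜 : Type*} [RCLike 𝕜] {p : ℝ} [Fact (1 ≤ p)] {v : Weight}
    {σ : ℤ} {R S : WeightedLp 𝕜 p v →L[𝕜] WeightedLp 𝕜 p v}
    (hR : IsShiftBy σ R) (hS : IsShiftBy (-σ) S)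
    (hmean : ∀ x y, HasSmallMeans fun n => ‖(R ^ n) x‖ + ‖(S ^ n) y‖) : IsHypercyclic R := by
  refine isHypercyclic_of_transitive R fun U V hU ⟨x, hx⟩ hV ⟨y, hy⟩ => ?_
  obtain ⟨δ, hδ, hδU⟩ := Metric.isOpen_iff.1 hU x hx
  obtain ⟨η, hη, hηV⟩ := Metric.isOpen_iff.1 hV y hy
  obtain ⟨n, hn⟩ := (hmean x y).exists_lt (lt_min hδ hη)
  have hRS : (R ^ n) ((S ^ n) y) = y := WeightedLp.ext fun j => by
    rw [hR.pow_apply, hS.pow_apply]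
    exact congrArg y.1 (by ring)
  have h1 := norm_nonneg ((R ^ n) x)
  have h2 := norm_nonneg ((S ^ n) y)
  refine ⟨n, x + (S ^ n) y, hδU ?_, hηV ?_⟩
  · rw [mem_ball_iff_norm, add_sub_cancel_left]
    linarith [min_le_left δ η]
  · rw [map_add, hRS, mem_ball_iff_norm, add_sub_cancel_right]
    linarith [min_le_right δ η]

/-- The even extension of `oscWeight` to `ℤ`. -/
noncomputable def oscWeightZ : Weight := fun j => ⟨oscWeight j.natAbs, oscWeight_pos _⟩

theorem oscWeightZ_add_le {m : ℤ} (hm : m.natAbs = 1) (j : ℤ) :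
    (oscWeightZ (j + m) : ℝ) ≤ 2 * oscWeightZ j :=
  oscWeight_slowlyVarying.le_two_mul oscWeight_pos (by omega) (by omega)

/-- All the dynamical properties, for both directions of the shift at once. -/
theorem IsShiftBy.dynamics {𝕜 : Type*} [RCLike 𝕜] {p : ℝ} [Fact (1 ≤ p)] {σ : ℤ}
    (hσ : σ.natAbs = 1) {R S : WeightedLp 𝕜 p oscWeightZ →L[𝕜] WeightedLp 𝕜 p oscWeightZ}
    (hR : IsShiftBy σ R) (hS : IsShiftBy (-σ) S) :
    CompletelyAbsolutelyMeanIrregular R ∧ CompletelyDistributionallyIrregular R ∧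
      IsHypercyclic R ∧ IsMeanLiYorkeSet R Set.univ := by
  obtain ⟨N, hN, hmin, hlim⟩ := exists_record_min_seq
  have hv : ∀ j, (oscWeightZ j : ℝ) = oscWeight j.natAbs := fun _ => rfl
  have htR := hR.tendsto_mean hσ hv oscWeight_slowlyVarying oscWeight_pos hN hmin hlim
  have htS := hS.tendsto_mean (by rwa [Int.natAbs_neg]) hv oscWeight_slowlyVarying
    oscWeight_pos hN hmin hlim
  have hsmall := fun x => HasSmallMeans.of_tendsto hN (htR x)
  have hlarge := fun (x : WeightedLp 𝕜 p oscWeightZ) (hx : x ≠ 0) =>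
    hR.largeCounts hσ hv oscWeight_slowlyVarying frequently_le_oscWeight hx
  have hnn := fun (x : WeightedLp 𝕜 p oscWeightZ) (n : ℕ) => norm_nonneg ((R ^ n) x)
  have hcami : CompletelyAbsolutelyMeanIrregular R := fun x hx =>
    ⟨(hsmall x).liminf_cesaroMean (hnn x),
      limsup_cesaroMean_of_largeCounts (hnn x) (hlarge x hx)⟩
  refine ⟨hcami, fun x hx => ⟨?_, exists_tendsto_atTop_of_largeCounts (hlarge x hx)⟩,
    hR.isHypercyclic hS fun x y => ?_,
    isMeanLiYorkeSet_univ hcami WeightedLp.not_countable_univ⟩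
  · obtain ⟨A, hA, ht⟩ := (hsmall x).exists_tendsto_zero (hnn x)
    exact ⟨A, hA, tendsto_zero_iff_norm_tendsto_zero.2 ht⟩
  · refine HasSmallMeans.of_tendsto hN ?_
    simpa [mul_add, Finset.sum_add_distrib] using (htR x).add (htS y)

theorem theorem6p4 (𝕜 : Type*) [RCLike 𝕜] :
    ∃ v : Weight, ∀ (p : ℝ) [Fact (1 ≤ p)],
      ∃ T : WeightedLp 𝕜 p v ≃L[𝕜] WeightedLp 𝕜 p v,
        IsForwardShift T ∧
        ∀ R ∈ ({T.toContinuousLinearMap, T.symm.toContinuousLinearMap} :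
            Set (WeightedLp 𝕜 p v →L[𝕜] WeightedLp 𝕜 p v)),
          CompletelyAbsolutelyMeanIrregular R ∧
          CompletelyDistributionallyIrregular R ∧
          IsHypercyclic R ∧
          IsMeanLiYorkeSet R Set.univ := by
  refine ⟨oscWeightZ, fun p _ => ?_⟩
  let F : WeightedLp 𝕜 p oscWeightZ →L[𝕜] WeightedLp 𝕜 p oscWeightZ :=
    WeightedLp.shift 1 2 (oscWeightZ_add_le rfl)
  let B : WeightedLp 𝕜 p oscWeightZ →L[𝕜] WeightedLp 𝕜 p oscWeightZ :=
    WeightedLp.shift (-1) 2 (oscWeightZ_add_le rfl)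
  have hF : IsShiftBy 1 F := fun _ _ => rfl
  have hB : IsShiftBy (-1) B := fun _ _ => rfl
  refine ⟨ContinuousLinearEquiv.equivOfInverse F B
    (fun x => WeightedLp.ext fun j => ?_) (fun x => WeightedLp.ext fun j => ?_),
    hF, fun R hR => ?_⟩
  · rw [hB, hF]
    exact congrArg x.1 (by ring)
  · rw [hF, hB]
    exact congrArg x.1 (by ring)
  · rcases hR with rfl | rfl
    · exact IsShiftBy.dynamics (σ := 1) rfl hF hB
    · exact IsShiftBy.dynamics (σ := -1) rfl hB hF
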